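/- Let $X$ be a pointed metric space with base point $0$, let $E,F$ be real Banach spaces, let $1<p\le\infty$ and let $p^*\in[1,\infty)$ be its conjugate exponent, $\frac1p+\frac1{p^*}=1$. Let $T\in LipL_0(X\times E;F)$, that is, $T:X\times E\to F$ is such that $T(x,\cdot)$ is linear for every $x\in X$, $T(0,e)=0$ for every $e\in E$, and there is a constant $K>0$ with $\|T(x,e)-T(y,e)\|\le K\,d(x,y)\,\|e\|$ for all $x,y\in X$, $e\in E$. Let $B_{F^{**}}$ denote the closed unit ball of the bidual $F^{**}$ with the weak-$*$ topology $\sigma(F^{**},F^*)$. The operator $T$ is called Cohen strongly $p$-summing if there is a constant $C>0$ such that for all $n$, $x_1,\dots,x_n,y_1,\dots,y_n\in X$, $e_1,\dots,e_n\in E$ and $z_1^*,\dots,z_n^*\in F^*$, $$\sum_{i=1}^n|\langle T(x_i,e_i)-T(y_i,e_i),z_i^*\rangle|\le C\Big(\sum_{i=1}^n\big(d(x_i,y_i)\|e_i\|\big)^p\Big)^{1/p}\sup_{z^{**}\in B_{F^{**}}}\Big(\sum_{i=1}^n|\langle z^{**},z_i^*\rangle|^{p^*}\Big)^{1/p^*}\qquad(1)$$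 (for $p=\infty$ the factor $(\sum_i(\cdot)^p)^{1/p}$ is replaced by $\max_i d(x_i,y_i)\|e_i\|$); in this case $d_p^{LipL}(T)$ denotes the infimum of the constants $C>0$ satisfying (1). The following are equivalent. 1. $T$ is Cohen strongly $p$-summing. 2. There are a constant $C>0$ and a Borel probability measure $\mu$ on $B_{F^{**}}$ such that for all $x,y\in X$, $e\in E$ and $z^*\in F^*$, $$|\langle T(x,e)-T(y,e),z^*\rangle|\le C\,d(x,y)\,\|e\|\Big(\int_{B_{F^{**}}}|\langle z^{**},z^*\rangle|^{p^*}\,d\mu(z^{**})\Big)^{1/p^*}.\qquad(2)$$ Moreover, in this case $d_p^{LipL}(T)$ is the infimum of all constants $C>0$ for which (2) holds for some Borel probability measure $\mu$ on $B_{F^{**}}$. -/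

import Mathlib

open MeasureTheory
open scoped ENNReal

/-- Lip-linear operators `T : X × E → F` vanishing at the base point `x₀` of `X`,
i.e. membership in `LipL₀(X × E; F)`. -/
structure IsLipLinear₀ {X E F : Type*} [MetricSpace X]
    [NormedAddCommGroup E] [NormedSpace ℝ E] [NormedAddCommGroup F] [NormedSpace ℝ F]
    (x₀ : X) (T : X × E → F) : Prop where
  linear : ∀ x, IsLinearMap ℝ (fun e => T (x, e))
  lipschitz : ∃ C : ℝ, 0 < C ∧ ∀ (x y : X) (e : E), ‖T (x, e) - T (y, e)‖ ≤ C * dist x y * ‖e‖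
  map_base : ∀ e, T (x₀, e) = 0

/-- The closed unit ball of the bidual `F**`, as a subspace of `F**` with its weak-star
topology `σ(F**, F*)`. -/
def BidualBall (F : Type*) [NormedAddCommGroup F] [NormedSpace ℝ F] : Type _ :=
  ↥(WeakDual.toStrongDual ⁻¹' Metric.closedBall (0 : StrongDual ℝ (StrongDual ℝ F)) 1 :
    Set (WeakDual ℝ (StrongDual ℝ F)))

namespace BidualBall

noncomputable instance {F : Type*} [NormedAddCommGroup F] [NormedSpace ℝ F] :
    TopologicalSpace (BidualBall F) :=
  instTopologicalSpaceSubtype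

/-- The Borel σ-algebra of the weak-star topology. -/
noncomputable instance {F : Type*} [NormedAddCommGroup F] [NormedSpace ℝ F] :
    MeasurableSpace (BidualBall F) :=
  borel _

instance {F : Type*} [NormedAddCommGroup F] [NormedSpace ℝ F] :
    BorelSpace (BidualBall F) :=
  ⟨rfl⟩

/-- The duality pairing `⟨z**, z*⟩`. -/
noncomputable def pair {F : Type*} [NormedAddCommGroup F] [NormedSpace ℝ F]
    (z : BidualBall F) (φ : StrongDual ℝ F) : ℝ :=
  WeakDual.toStrongDual z.1 φ

end BidualBall

/-- `C` satisfies the Cohen strong `p`-summability inequality for `T`. The norm in `PiLp p`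
is the `ℓ_p` norm of a finite family (the maximum if `p = ∞`), and `p.conjExponent` is the
conjugate exponent `p*`, which is finite for `1 < p ≤ ∞`. -/
def CohenBound {X E F : Type*} [MetricSpace X]
    [NormedAddCommGroup E] [NormedSpace ℝ E] [NormedAddCommGroup F] [NormedSpace ℝ F]
    (p : ℝ≥0∞) (T : X × E → F) (C : ℝ) : Prop :=
  ∀ (n : ℕ) (x y : Fin n → X) (e : Fin n → E) (φ : Fin n → StrongDual ℝ F),
    ∑ i, |φ i (T (x i, e i) - T (y i, e i))| ≤
      C * ‖(WithLp.toLp p (fun i => dist (x i) (y i) * ‖e i‖) : PiLp p (fun _ : Fin n => ℝ))‖ *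
        ⨆ z : BidualBall F,
          (∑ i, |z.pair (φ i)| ^ p.conjExponent.toReal) ^ (1 / p.conjExponent.toReal)

/-- `T` is Cohen strongly `p`-summing. -/
def IsCohenStronglySumming {X E F : Type*} [MetricSpace X]
    [NormedAddCommGroup E] [NormedSpace ℝ E] [NormedAddCommGroup F] [NormedSpace ℝ F]
    (p : ℝ≥0∞) (T : X × E → F) : Prop :=
  ∃ C : ℝ, 0 < C ∧ CohenBound p T C

/-- The norm `d_p^{LipL}(T)`: the infimum of the constants `C > 0` in the Cohen strong
`p`-summability inequality. -/
noncomputable def cohenNorm {X E F : Type*} [MetricSpace X]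
    [NormedAddCommGroup E] [NormedSpace ℝ E] [NormedAddCommGroup F] [NormedSpace ℝ F]
    (p : ℝ≥0∞) (T : X × E → F) : ℝ :=
  sInf {C : ℝ | 0 < C ∧ CohenBound p T C}

/-- The domination inequality for `T` with constant `C` and measure `μ` on `B_{F**}`. -/
def DominatedBy {X E F : Type*} [MetricSpace X]
    [NormedAddCommGroup E] [NormedSpace ℝ E] [NormedAddCommGroup F] [NormedSpace ℝ F]
    (p : ℝ≥0∞) (T : X × E → F) (C : ℝ) (μ : Measure (BidualBall F)) : Prop :=
  ∀ (x y : X) (e : E) (φ : StrongDual ℝ F),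
    |φ (T (x, e) - T (y, e))| ≤
      C * dist x y * ‖e‖ *
        (∫ z, |z.pair φ| ^ p.conjExponent.toReal ∂μ) ^ (1 / p.conjExponent.toReal)

/-! Each constant `C > 0` satisfies the summing inequality iff it satisfies the domination
inequality for some probability `μ`; this gives both the equivalence and the formula for the norm.
Write `q` for `p*`. Domination implies summing by Hölder. Conversely, normalise `d(x,y)‖e‖ = 1` and
consider the functions `|φ(T(x,e) - T(y,e))|^q - C^q |⟨·,φ⟩|^q` on the weak-star compact ball. The
summing inequality, tested at the equality case of Hölder, makes every convex combination of them
nonpositive somewhere (`CohenBound.exists_sum_rpow_le`). Hahn-Banach separation from the strictly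
positive functions, with Riesz representation, yields `μ`
(`exists_isProbabilityMeasure_integral_nonpos`). -/

open scoped CompactlySupported

/-! ### Separation and Riesz representation on a compact space -/

section Pietsch

/-- A positive linear functional on `C(K, ℝ)`, `K` compact Hausdorff, with value `1` at `1`, is
integration against a Borel probability measure. -/
theorem exists_isProbabilityMeasure_integral_eq {K : Type*} [TopologicalSpace K] [CompactSpace K]
    [T2Space K] [MeasurableSpace K] [BorelSpace K] (L : C(K, ℝ) →ₗ[ℝ] ℝ)
    (hL : ∀ f : C(K, ℝ), 0 ≤ f → 0 ≤ L f) (hL1 : L 1 = 1) :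
    ∃ μ : Measure K, IsProbabilityMeasure μ ∧ ∀ f : C(K, ℝ), ∫ z, f z ∂μ = L f := by
  let Λ : C_c(K, ℝ) →ₚ[ℝ] ℝ := PositiveLinearMap.mk₀
    { toFun := fun f => L f.toContinuousMap
      map_add' := fun f g => by
        rw [← map_add]; rfl
      map_smul' := fun c f => by
        rw [RingHom.id_apply, ← map_smul]; rfl }
    (fun f hf => hL _ fun z => hf z)
  have key : ∀ f : C(K, ℝ), ∫ z, f z ∂(RealRMK.rieszMeasure Λ) = L f := fun f =>
    RealRMK.integral_rieszMeasure Λ (CompactlySupportedContinuousMap.continuousMapEquiv f)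
  refine ⟨RealRMK.rieszMeasure Λ, ⟨?_⟩, key⟩
  have h1 := key 1
  simp only [ContinuousMap.one_apply, integral_const, smul_eq_mul, mul_one, hL1] at h1
  rw [measureReal_def] at h1
  rw [← ENNReal.toReal_eq_one_iff]
  exact h1

/-- If every element of a convex set of continuous functions on a compact Hausdorff space takes a
nonpositive value somewhere, then some probability measure integrates all of them to nonpositive
numbers. -/
theorem exists_isProbabilityMeasure_integral_nonpos {K : Type*} [TopologicalSpace K]
    [CompactSpace K] [T2Space K] [Nonempty K] [MeasurableSpace K] [BorelSpace K]
    {G : Set C(K, ℝ)} (hG : Convex ℝ G) (hG0 : ∀ g ∈ G, ∃ z, g z ≤ 0) :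
    ∃ μ : Measure K, IsProbabilityMeasure μ ∧ ∀ g ∈ G, ∫ z, g z ∂μ ≤ 0 := by
  rcases G.eq_empty_or_nonempty with rfl | ⟨g₀, hg₀⟩
  · exact ⟨Measure.dirac (Classical.arbitrary K), inferInstance, by simp⟩
  let P : Set C(K, ℝ) := {f | ∀ z, 0 < f z}
  have hPo : IsOpen P := by
    have h := ContinuousMap.isOpen_setOfPred_mapsTo (X := K) (Y := ℝ) isCompact_univ
      (isOpen_Ioi (a := (0 : ℝ)))
    convert h using 1
    ext f
    simp [P, Set.MapsTo]
  have hPc : Convex ℝ P := by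
    intro f hf g hg a b ha hb hab z
    have h1 := hf z
    have h2 := hg z
    simp only [ContinuousMap.add_apply, ContinuousMap.smul_apply, smul_eq_mul]
    rcases ha.eq_or_lt with rfl | ha
    · simp_all
    · nlinarith [mul_pos ha h1, mul_nonneg hb h2.le]
  have hdisj : Disjoint P G := by
    rw [Set.disjoint_left]
    intro f hf hfG
    obtain ⟨z, hz⟩ := hG0 f hfG
    exact absurd (hf z) (not_lt.2 hz)
  obtain ⟨u, s, hu, hs⟩ := geometric_hahn_banach_open hPc hPo hG hdisj
  have hPsmul : ∀ f ∈ P, ∀ t : ℝ, 0 < t → t • f ∈ P := fun f hf t ht z => by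
    simpa using mul_pos ht (hf z)
  have hone : (1 : C(K, ℝ)) ∈ P := fun z => by simp
  -- `P` is a cone: if `s < 0`, a multiple of `1` has `u`-value `s / 2 > s`.
  have hs0 : 0 ≤ s := by
    by_contra! h
    have h1 : u 1 < 0 := (hu 1 hone).trans h
    have h2 := hu _ (hPsmul 1 hone (s / (2 * u 1)) (div_pos_of_neg_of_neg h (by linarith)))
    rw [map_smul, smul_eq_mul, div_mul_eq_mul_div, mul_div_mul_right _ _ h1.ne] at h2
    linarith
  have huP : ∀ f ∈ P, u f ≤ 0 := by
    intro f hf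
    by_contra! h
    have h2 := hu _ (hPsmul f hf ((s + 1) / u f) (by positivity))
    rw [map_smul, smul_eq_mul, div_mul_cancel₀ _ h.ne'] at h2
    linarith
  have hu0 : ∀ f : C(K, ℝ), 0 ≤ f → u f ≤ 0 := by
    intro f hf
    have h : ∀ ε : ℝ, 0 < ε → u f ≤ ε * -u 1 := fun ε hε => by
      have := huP (f + ε • (1 : C(K, ℝ))) fun z => by
        have : 0 ≤ f z := hf z
        simp only [ContinuousMap.add_apply, ContinuousMap.smul_apply, ContinuousMap.one_apply,
          smul_eq_mul, mul_one]
        linarith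
      rw [map_add, map_smul, smul_eq_mul] at this
      linarith
    have h1 : 0 ≤ -u 1 := by linarith [huP 1 hone]
    refine le_of_forall_pos_le_add fun ε hε => ?_
    have h2 := h (ε / (-u 1 + 1)) (by positivity)
    have h3 : ε / (-u 1 + 1) * -u 1 ≤ ε := by
      rw [div_mul_eq_mul_div, div_le_iff₀ (by positivity)]
      nlinarith
    linarith
  -- If `u 1 = 0`, adding `‖g₀‖` to `g₀` gives `u g₀ ≤ 0`, against `0 = u 1 < s ≤ u g₀`.
  have hu1 : u 1 < 0 := by
    refine lt_of_le_of_ne (huP 1 hone) fun h => ?_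
    have h2 := hu0 (‖g₀‖ • (1 : C(K, ℝ)) + g₀) fun z => by
      have := (neg_le_abs _).trans (g₀.norm_coe_le_norm z)
      change 0 ≤ ‖g₀‖ * 1 + g₀ z
      linarith
    rw [map_add, map_smul, h, smul_zero, zero_add] at h2
    have h3 := hu 1 hone
    have h4 := hs g₀ hg₀
    linarith
  -- Dividing by `u 1 < 0` makes `u` positive and normalised, and reverses the sign on `G`.
  obtain ⟨μ, hμ, hint⟩ := exists_isProbabilityMeasure_integral_eq
    ((u 1)⁻¹ • (u : C(K, ℝ) →ₗ[ℝ] ℝ))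
    (fun f hf => by
      simpa using mul_nonneg_of_nonpos_of_nonpos (inv_nonpos.2 hu1.le) (hu0 f hf))
    (by simpa using inv_mul_cancel₀ hu1.ne)
  refine ⟨μ, hμ, fun g hg => ?_⟩
  rw [hint]
  simpa using mul_nonpos_of_nonpos_of_nonneg (inv_nonpos.2 hu1.le) (hs0.trans (hs g hg))

end Pietsch

/-! ### Topology of the bidual ball -/

namespace BidualBall

variable {F : Type*} [NormedAddCommGroup F] [NormedSpace ℝ F]

instance : CompactSpace (BidualBall F) :=
  isCompact_iff_compactSpace.1 (WeakDual.isCompact_closedBall _ _)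

instance : T2Space (BidualBall F) :=
  inferInstanceAs (T2Space (Subtype _))

instance : Nonempty (BidualBall F) :=
  ⟨⟨0, by simp⟩⟩

theorem continuous_pair (φ : StrongDual ℝ F) : Continuous fun z : BidualBall F => z.pair φ :=
  (WeakDual.eval_continuous φ).comp continuous_subtype_val

theorem pair_smul (z : BidualBall F) (c : ℝ) (φ : StrongDual ℝ F) :
    z.pair (c • φ) = c * z.pair φ := by
  simp [pair]

theorem continuous_abs_pair_rpow {q : ℝ} (hq : 0 ≤ q) (φ : StrongDual ℝ F) :
    Continuous fun z : BidualBall F => |z.pair φ| ^ q :=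
  (continuous_pair φ).abs.rpow_const fun _ => Or.inr hq

end BidualBall

/-! ### Conjugate exponents and Hölder's inequality -/

section Exponents

theorem one_le_toReal_conjExponent {p : ℝ≥0∞} (hp : 1 < p) : 1 ≤ p.conjExponent.toReal := by
  have h : p.conjExponent ≠ ∞ := by
    simp [ENNReal.conjExponent, tsub_eq_zero_iff_le, hp]
  rw [← ENNReal.toReal_one]
  exact ENNReal.toReal_mono h (by simp [ENNReal.conjExponent])

theorem toReal_conjExponent_top : (∞ : ℝ≥0∞).conjExponent.toReal = 1 := by
  simp [ENNReal.conjExponent]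

theorem holderConjugate_toReal_conjExponent {p : ℝ≥0∞} (hp : 1 < p) (hp' : p ≠ ∞) :
    p.toReal.HolderConjugate p.conjExponent.toReal := by
  have := ENNReal.HolderConjugate.conjExponent hp.le
  refine ENNReal.HolderConjugate.toReal (q := p.conjExponent) ?_
  rw [← ENNReal.toReal_one]
  exact (ENNReal.toReal_lt_toReal ENNReal.one_ne_top hp').2 hp

/-- Hölder's inequality for finite families, with the `PiLp` norm. -/
theorem sum_mul_le_norm_toLp_mul {n : ℕ} {p : ℝ≥0∞} (hp : 1 < p) {c d : Fin n → ℝ}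
    (hc : ∀ i, 0 ≤ c i) (hd : ∀ i, 0 ≤ d i) :
    ∑ i, c i * d i ≤ ‖(WithLp.toLp p c : PiLp p (fun _ : Fin n => ℝ))‖ *
      (∑ i, d i ^ p.conjExponent.toReal) ^ (1 / p.conjExponent.toReal) := by
  by_cases hp' : p = ∞
  · subst hp'
    simp only [toReal_conjExponent_top, Real.rpow_one, div_one, PiLp.norm_eq_ciSup,
      Finset.mul_sum]
    refine Finset.sum_le_sum fun i _ => mul_le_mul_of_nonneg_right ?_ (hd i)
    exact (Real.le_norm_self _).trans
      (le_ciSup (f := fun i => ‖c i‖) (Set.finite_range _).bddAbove i)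
  · have h := holderConjugate_toReal_conjExponent hp hp'
    rw [PiLp.norm_eq_sum h.pos]
    simpa [abs_of_nonneg, hc, hd] using
      Real.inner_le_Lp_mul_Lq_of_nonneg Finset.univ h (fun i _ => hc i) (fun i _ => hd i)

/-- For finite `p` this is an equality, from `(q - 1) p = q` and `1 - 1/q = 1/p`. For `p = ∞` all
entries are `1`, and the inequality is strict only for the empty family. -/
theorem norm_toLp_rpow_sub_one_le {n : ℕ} {p : ℝ≥0∞} (hp : 1 < p) {d : Fin n → ℝ}
    (hd : ∀ i, 0 ≤ d i) :
    ‖(WithLp.toLp p (fun i => d i ^ (p.conjExponent.toReal - 1)) :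
        PiLp p (fun _ : Fin n => ℝ))‖ ≤
      (∑ i, d i ^ p.conjExponent.toReal) ^ (1 - 1 / p.conjExponent.toReal) := by
  by_cases hp' : p = ∞
  · subst hp'
    simp only [toReal_conjExponent_top, PiLp.norm_eq_ciSup, sub_self, div_one, Real.rpow_zero]
    exact Real.iSup_le (fun i => by simp) zero_le_one
  · have h := holderConjugate_toReal_conjExponent hp hp'
    rw [PiLp.norm_eq_sum h.pos]
    have h1 : 1 - 1 / p.conjExponent.toReal = 1 / p.toReal := by
      have := h.inv_add_inv_eq_one
      simp only [one_div]
      linarith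
    rw [h1]
    refine le_of_eq ?_
    congr 1
    refine Finset.sum_congr rfl fun i _ => ?_
    rw [Real.norm_of_nonneg (Real.rpow_nonneg (hd i) _), ← Real.rpow_mul (hd i),
      h.symm.sub_one_mul_conj]

end Exponents

/-! ### The two implications, with the same constant -/

section Domination

variable {X E F : Type*} [MetricSpace X] [NormedAddCommGroup E] [NormedSpace ℝ E]
  [NormedAddCommGroup F] [NormedSpace ℝ F] {p : ℝ≥0∞} {T : X × E → F} {C : ℝ}

/-- After Hölder, the `q`-th powers of the `L^q(μ)` norms sum to one integral, which the supremum
bounds because `μ` has mass one. -/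
theorem DominatedBy.cohenBound (hp : 1 < p) (hC : 0 < C) {μ : Measure (BidualBall F)}
    [IsProbabilityMeasure μ] (h : DominatedBy p T C μ) : CohenBound p T C := by
  intro n x y e φ
  set q := p.conjExponent.toReal with hqdef
  have hq : 1 ≤ q := one_le_toReal_conjExponent hp
  have hq0 : 0 < q := by linarith
  set S := ⨆ z : BidualBall F, (∑ i, |z.pair (φ i)| ^ q) ^ (1 / q) with hS
  have hcont : Continuous fun z : BidualBall F => ∑ i, |z.pair (φ i)| ^ q :=
    continuous_finsetSum _ fun i _ => BidualBall.continuous_abs_pair_rpow hq0.le (φ i)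
  have hnn : ∀ z : BidualBall F, 0 ≤ ∑ i, |z.pair (φ i)| ^ q := fun z => by positivity
  have hbdd : BddAbove (Set.range fun z : BidualBall F => (∑ i, |z.pair (φ i)| ^ q) ^ (1 / q)) :=
    (isCompact_range (hcont.rpow_const fun _ => Or.inr (by positivity))).bddAbove
  have hS0 : 0 ≤ S := Real.iSup_nonneg fun z => by positivity
  have hint : ∀ i, Integrable (fun z : BidualBall F => |z.pair (φ i)| ^ q) μ := fun i =>
    (BidualBall.continuous_abs_pair_rpow hq0.le (φ i)).integrable_of_hasCompactSupport
      (HasCompactSupport.of_compactSpace _)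
  let d : Fin n → ℝ := fun i => (∫ z, |z.pair (φ i)| ^ q ∂μ) ^ (1 / q)
  have hI : ∀ i, 0 ≤ ∫ z, |z.pair (φ i)| ^ q ∂μ := fun i => integral_nonneg fun z => by positivity
  have hd : ∀ i, 0 ≤ d i := fun i => Real.rpow_nonneg (hI i) _
  have hdS : (∑ i, d i ^ q) ^ (1 / q) ≤ S := by
    have h1 : ∑ i, d i ^ q = ∫ z, ∑ i, |z.pair (φ i)| ^ q ∂μ := by
      rw [integral_finsetSum _ fun i _ => hint i]
      refine Finset.sum_congr rfl fun i _ => ?_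
      rw [← Real.rpow_mul (hI i), one_div_mul_cancel hq0.ne', Real.rpow_one]
    have h2 : ∫ z, ∑ i, |z.pair (φ i)| ^ q ∂μ ≤ S ^ q := by
      have h3 : ∀ z : BidualBall F, ∑ i, |z.pair (φ i)| ^ q ≤ S ^ q := fun z => by
        rw [← Real.rpow_inv_le_iff_of_pos (hnn z) hS0 hq0, ← one_div]
        exact le_ciSup hbdd z
      calc ∫ z, ∑ i, |z.pair (φ i)| ^ q ∂μ ≤ ∫ _, S ^ q ∂μ :=
            integral_mono (integrable_finsetSum _ fun i _ => hint i) (integrable_const _) h3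
        _ = S ^ q := by simp
    rw [h1, one_div, Real.rpow_inv_le_iff_of_pos (integral_nonneg hnn) hS0 hq0]
    exact h2
  calc ∑ i, |φ i (T (x i, e i) - T (y i, e i))|
      ≤ ∑ i, C * ((dist (x i) (y i) * ‖e i‖) * d i) :=
        Finset.sum_le_sum fun i _ => (h (x i) (y i) (e i) (φ i)).trans_eq (by simp only [d]; ring)
    _ = C * ∑ i, (dist (x i) (y i) * ‖e i‖) * d i := by rw [Finset.mul_sum]
    _ ≤ C * (_ * (∑ i, d i ^ q) ^ (1 / q)) :=
        mul_le_mul_of_nonneg_left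
          (sum_mul_le_norm_toLp_mul hp (fun i => by positivity) hd) hC.le
    _ ≤ C * (_ * S) := by
        have : Fact (1 ≤ p) := ⟨hp.le⟩
        gcongr
    _ = _ := by rw [mul_assoc]

/-- The discretised form of the domination: for normalised data, the `p*`-th powers are
controlled by a single point of the bidual ball. -/
theorem CohenBound.exists_sum_rpow_le (hp : 1 < p) (hC : 0 < C)
    (hT : ∀ x, IsLinearMap ℝ (fun e => T (x, e))) (h : CohenBound p T C) {n : ℕ}
    (x y : Fin n → X) (e : Fin n → E) (φ : Fin n → StrongDual ℝ F)
    (hxe : ∀ i, dist (x i) (y i) * ‖e i‖ = 1) :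
    ∃ z : BidualBall F, ∑ i, |φ i (T (x i, e i) - T (y i, e i))| ^ p.conjExponent.toReal ≤
      C ^ p.conjExponent.toReal * ∑ i, |z.pair (φ i)| ^ p.conjExponent.toReal := by
  set q := p.conjExponent.toReal with hqdef
  have hq : 1 ≤ q := one_le_toReal_conjExponent hp
  have hq0 : 0 < q := by linarith
  have hcont : Continuous fun z : BidualBall F => ∑ i, |z.pair (φ i)| ^ q :=
    continuous_finsetSum _ fun i _ => BidualBall.continuous_abs_pair_rpow hq0.le (φ i)
  obtain ⟨z₀, -, hz₀⟩ := isCompact_univ.exists_isMaxOn Set.univ_nonempty hcont.continuousOn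
  refine ⟨z₀, ?_⟩
  set M := ∑ i, |z₀.pair (φ i)| ^ q with hM
  have hM0 : 0 ≤ M := by positivity
  set b : Fin n → ℝ := fun i => |φ i (T (x i, e i) - T (y i, e i))| with hb
  have hb0 : ∀ i, 0 ≤ b i := fun i => abs_nonneg _
  set N := ∑ i, b i ^ q with hN
  have hN0 : 0 ≤ N := Finset.sum_nonneg fun i _ => Real.rpow_nonneg (hb0 i) _
  have hsup : ⨆ z : BidualBall F, (∑ i, |z.pair (φ i)| ^ q) ^ (1 / q) ≤ M ^ (1 / q) :=
    ciSup_le fun z => Real.rpow_le_rpow (by positivity) (hz₀ (Set.mem_univ z)) (by positivity)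
  -- Equality case of Hölder: with these weights the left side becomes `N` and the `ℓ_p` norm is at
  -- most `N ^ (1 - 1 / q)`, which is then cancelled.
  have h1 := h n x y (fun i => b i ^ (q - 1) • e i) φ
  have h2 : ∀ i, |φ i (T (x i, b i ^ (q - 1) • e i) - T (y i, b i ^ (q - 1) • e i))| =
      b i ^ q := fun i => by
    have hc := Real.rpow_nonneg (hb0 i) (q - 1)
    rw [(hT (x i)).map_smul, (hT (y i)).map_smul, ← smul_sub, map_smul, smul_eq_mul, abs_mul,
      abs_of_nonneg hc]
    conv_lhs => rw [show |φ i (T (x i, e i) - T (y i, e i))| = b i ^ (1 : ℝ) by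
      rw [Real.rpow_one]]
    rw [← Real.rpow_add_of_nonneg (hb0 i) (by linarith) zero_le_one, sub_add_cancel]
  have h3 : ∀ i, dist (x i) (y i) * ‖b i ^ (q - 1) • e i‖ = b i ^ (q - 1) := fun i => by
    rw [norm_smul, Real.norm_of_nonneg (Real.rpow_nonneg (hb0 i) _), mul_left_comm, hxe, mul_one]
  simp only [h2, h3] at h1
  have h4 : N ≤ C * N ^ (1 - 1 / q) * M ^ (1 / q) := by
    refine h1.trans ?_
    have := norm_toLp_rpow_sub_one_le hp hb0
    have h0 : 0 ≤ ⨆ z : BidualBall F, (∑ i, |z.pair (φ i)| ^ q) ^ (1 / q) :=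
      Real.iSup_nonneg fun z => by positivity
    gcongr
  rcases hN0.eq_or_lt with h0 | hNpos
  · rw [← h0]; positivity
  · have h5 : N ^ (1 / q) ≤ C * M ^ (1 / q) := by
      have h6 : N = N ^ (1 - 1 / q) * N ^ (1 / q) := by
        rw [← Real.rpow_add hNpos, sub_add_cancel, Real.rpow_one]
      have h7 : 0 < N ^ (1 - 1 / q) := Real.rpow_pos_of_pos hNpos _
      refine le_of_mul_le_mul_left ?_ h7
      rw [← h6]
      exact h4.trans_eq (by ring)
    rw [one_div, Real.rpow_inv_le_iff_of_pos hN0 (by positivity) hq0,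
      Real.mul_rpow hC.le (by positivity), ← Real.rpow_mul hM0, inv_mul_cancel₀ hq0.ne',
      Real.rpow_one] at h5
    exact h5

theorem CohenBound.exists_dominatedBy (hp : 1 < p) (hC : 0 < C)
    (hT : ∀ x, IsLinearMap ℝ (fun e => T (x, e))) (h : CohenBound p T C) :
    ∃ μ : Measure (BidualBall F), IsProbabilityMeasure μ ∧ DominatedBy p T C μ := by
  set q := p.conjExponent.toReal with hqdef
  have hq : 1 ≤ q := one_le_toReal_conjExponent hp
  have hq0 : 0 < q := by linarith
  let f : StrongDual ℝ F → C(BidualBall F, ℝ) := fun φ =>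
    ⟨fun z => |z.pair φ| ^ q, BidualBall.continuous_abs_pair_rpow hq0.le φ⟩
  let B : Set C(BidualBall F, ℝ) := {g | ∃ (x y : X) (e : E) (φ : StrongDual ℝ F),
    dist x y * ‖e‖ = 1 ∧
      g = ContinuousMap.const _ (|φ (T (x, e) - T (y, e))| ^ q) - C ^ q • f φ}
  have hB : ∀ g ∈ convexHull ℝ B, ∃ z, g z ≤ 0 := by
    intro g hg
    obtain ⟨ι, _, w, v, hw, -, hv, rfl⟩ := mem_convexHull_iff_exists_fintype.1 hg
    choose x y e φ hxe hve using hv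
    let σ := (Fintype.equivFin ι).symm
    -- Both terms are homogeneous of degree `q` in `φ`, so the convex weights are absorbed as `w ^
    -- (1 / q)`.
    obtain ⟨z, hz⟩ := h.exists_sum_rpow_le hp hC hT (x ∘ σ) (y ∘ σ) (e ∘ σ)
      (fun i => (w (σ i)) ^ (1 / q) • φ (σ i)) (fun i => hxe (σ i))
    refine ⟨z, ?_⟩
    have hpow : ∀ (i : ι) (t : ℝ), |w i ^ (1 / q) * t| ^ q = w i * |t| ^ q := fun i t => by
      have := hw i
      rw [abs_mul, abs_of_nonneg (by positivity), Real.mul_rpow (by positivity) (abs_nonneg _),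
        ← Real.rpow_mul this, one_div_mul_cancel hq0.ne', Real.rpow_one]
    simp only [← hqdef, Function.comp_apply, smul_apply, smul_eq_mul,
      BidualBall.pair_smul, hpow] at hz
    rw [σ.sum_comp (fun i => w i * |φ i (T (x i, e i) - T (y i, e i))| ^ q),
      σ.sum_comp (fun i => w i * |z.pair (φ i)| ^ q), Finset.mul_sum] at hz
    simp only [hve, ContinuousMap.coe_sum, Finset.sum_apply, ContinuousMap.smul_apply,
      ContinuousMap.sub_apply, ContinuousMap.const_apply, smul_eq_mul, mul_sub,
      Finset.sum_sub_distrib, sub_nonpos, f, ContinuousMap.coe_mk]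
    exact hz.trans_eq (Finset.sum_congr rfl fun i _ => by ring)
  obtain ⟨μ, hμ, hμB⟩ := exists_isProbabilityMeasure_integral_nonpos (convex_convexHull ℝ B) hB
  refine ⟨μ, hμ, fun x y e φ => ?_⟩
  rw [← hqdef]
  have hI : 0 ≤ ∫ z : BidualBall F, |z.pair φ| ^ q ∂μ := integral_nonneg fun z => by positivity
  have hnorm : ∀ e : E, dist x y * ‖e‖ = 1 → |φ (T (x, e) - T (y, e))| ≤
      C * (∫ z, |z.pair φ| ^ q ∂μ) ^ (1 / q) := fun e he => by
    have h1 := hμB _ (subset_convexHull ℝ B ⟨x, y, e, φ, he, rfl⟩)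
    have hint : Integrable (fun z : BidualBall F => |z.pair φ| ^ q) μ :=
      (BidualBall.continuous_abs_pair_rpow hq0.le φ).integrable_of_hasCompactSupport
        (HasCompactSupport.of_compactSpace _)
    simp only [ContinuousMap.sub_apply, ContinuousMap.const_apply, ContinuousMap.smul_apply,
      smul_eq_mul, f, ContinuousMap.coe_mk] at h1
    rw [integral_sub (integrable_const _) (hint.const_mul _), integral_const_mul] at h1
    simp only [integral_const, probReal_univ, one_smul, sub_nonpos] at h1
    rw [← Real.rpow_le_rpow_iff (abs_nonneg _) (by positivity) hq0,
      Real.mul_rpow hC.le (by positivity), ← Real.rpow_mul hI, one_div_mul_cancel hq0.ne',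
      Real.rpow_one]
    exact h1
  have ha : 0 ≤ dist x y * ‖e‖ := by positivity
  -- Degenerate data make the left side vanish; otherwise rescale `e` to the normalised case.
  rcases ha.eq_or_lt with h0 | hpos
  · rcases mul_eq_zero.1 h0.symm with hd | he
    · rw [dist_eq_zero.1 hd]; simp
    · rw [norm_eq_zero.1 he, (hT x).map_zero, (hT y).map_zero]; simp
  · set a := dist x y * ‖e‖ with hadef
    have h1 := hnorm (a⁻¹ • e) (by
      rw [norm_smul, norm_inv, Real.norm_of_nonneg ha, mul_left_comm, ← hadef,
        inv_mul_cancel₀ hpos.ne'])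
    rw [(hT x).map_smul, (hT y).map_smul, ← smul_sub, map_smul, smul_eq_mul, abs_mul,
      abs_of_pos (inv_pos.2 hpos), inv_mul_le_iff₀ hpos] at h1
    exact h1.trans_eq (by rw [hadef]; ring)

end Domination

theorem mainTheorem6 {X E F : Type*} [MetricSpace X]
    [NormedAddCommGroup E] [NormedSpace ℝ E] [CompleteSpace E]
    [NormedAddCommGroup F] [NormedSpace ℝ F] [CompleteSpace F]
    (p : ℝ≥0∞) (hp : 1 < p) (x₀ : X) (T : X × E → F) (hT : IsLipLinear₀ x₀ T) :
    (IsCohenStronglySumming p T ↔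
      ∃ C : ℝ, 0 < C ∧ ∃ μ : Measure (BidualBall F), IsProbabilityMeasure μ ∧
        DominatedBy p T C μ) ∧
    (IsCohenStronglySumming p T →
      IsGLB {C : ℝ | 0 < C ∧ ∃ μ : Measure (BidualBall F), IsProbabilityMeasure μ ∧
        DominatedBy p T C μ} (cohenNorm p T)) := by
  have key : ∀ C : ℝ, (0 < C ∧ CohenBound p T C) ↔
      (0 < C ∧ ∃ μ : Measure (BidualBall F), IsProbabilityMeasure μ ∧ DominatedBy p T C μ) :=
    fun C => and_congr_right fun hC =>
      ⟨fun h => h.exists_dominatedBy hp hC hT.linear, fun ⟨_, _, h⟩ => h.cohenBound hp hC⟩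
  refine ⟨exists_congr key, fun hsum => ?_⟩
  simp only [← key, cohenNorm]
  exact isGLB_csInf hsum ⟨0, fun C hC => hC.1.le⟩
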